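/- Let $(\Omega,\mathcal F,P)$ be a probability space, $(\Omega_S,\mathcal F_S)$ a measurable space, $m$ a positive integer, and $C:\Omega_S\to \mathrm{Pow}(\mathbb R^m)$ a set-valued map such that: 1. there is a measurable function $\psi:\Omega_S\to\mathbb R^m$ with $\psi(s)\in C(s)$ for all $s\in\Omega_S$; 2. $\{(s,x)\in\Omega_S\times\mathbb R^m : x\in C(s)\}\in\mathcal F_S\otimes\mathcal B(\mathbb R^m)$; 3. there is a bounded set $D\subseteq\mathbb R^m$ such that $C(s)$ is nonempty and $C(s)\subseteq D$ for all $s\in\Omega_S$. For a probability measure $\lambda$ on $(\Omega_S,\mathcal F_S)$, let the rate region $\Gamma\subseteq\mathbb R^m$ be the set of all expectations $\mathbb E[v(S,U)]$, where $v:\Omega_S\times\mathbb R\to\mathbb R^m$ is measurable with $v(s,w)\in C(s)$ for all $s\in\Omega_S$, $w\in\mathbb R$, and where $S$ and $U$ are independent random elements on some probability space, $S$ having distribution $\lambda$ and $U$ being uniformly distributed on $[0,1]$. Let $\overline\Gamma$ be the closure of $\Gamma$. Let $(S_k)_{k=1}^\infty$ be identically distributed random elements $S_k:\Omega\to\Omega_S$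 with distribution $\lambda$, and let $(X_k)_{k=1}^\infty$ be Borel measurable random vectors $X_k:\Omega\to\mathbb R^m$ such that $X_k(\omega)\in C(S_k(\omega))$ for all $k\ge 1$ and all $\omega\in\Omega$. Then: (a) For all $k\ge 1$ we have $\mathbb E[X_k]\in\Gamma$ and $\frac1k\sum_{i=1}^k\mathbb E[X_i]\in\Gamma$. (b) If $(S_k)_{k=1}^\infty$ is i.i.d. and, for every $k\ge 2$, $S_k$ is independent of $(X_1,\dots,X_{k-1})$, then for all $k\ge 1$ $$\mathbb E[X_k\mid\mathcal H_k]\in\overline\Gamma\quad\text{almost surely},$$ where $\mathcal H_k=\sigma(X_1,\dots,X_{k-1})$ for $k\ge2$ and $\mathcal H_1=\{\emptyset,\Omega\}$. (c) Under the same hypotheses as in (b), $$\lim_{k\to\infty}\mathrm{dist}\Big(\frac1k\sum_{i=1}^kX_i,\ \overline\Gamma\Big)=0\quad\text{almost surely},$$ where $\mathrm{dist}(x,\overline\Gamma)$ is the Euclidean distance from the point $x\in\mathbb R^m$ to the set $\overline\Gamma$. -/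

import Mathlib

open MeasureTheory ProbabilityTheory Filter Topology

universe u

/-- The rate region `Γ` of a state distribution `lam` on `ΩS` and an option map
`C : ΩS → Set ℝ^m`: the set of all expectations `E[v(T, U)]`, where `v : ΩS × ℝ → ℝ^m` is measurable
with `v (s, w) ∈ C s` for all `s`, `w`, and `T`, `U` are independent random elements on some
probability space, `T` having distribution `lam` and `U` being uniform on `[0,1]`.
(`volume` on `unitInterval` is the uniform distribution; the universe of `ΩS` contains the
probability space `ΩS × [0,1]`, on which such a pair exists.) -/
def rateRegion {ΩS : Type u} [MeasurableSpace ΩS] {m : ℕ} (lam : Measure ΩS)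
    (C : ΩS → Set (EuclideanSpace ℝ (Fin m))) : Set (EuclideanSpace ℝ (Fin m)) :=
  {x | ∃ v : ΩS × ℝ → EuclideanSpace ℝ (Fin m),
    Measurable v ∧ (∀ s w, v (s, w) ∈ C s) ∧
    ∃ (Ω' : Type u) (_ : MeasurableSpace Ω') (P' : Measure Ω') (T : Ω' → ΩS)
      (U : Ω' → unitInterval),
      IsProbabilityMeasure P' ∧ Measurable T ∧ Measurable U ∧
      P'.map T = lam ∧ P'.map U = volume ∧ IndepFun T U P' ∧
      x = ∫ ω, v (T ω, (U ω : ℝ)) ∂P'}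

/-- The random vector of the first `k` decisions `X 0, …, X (k - 1)`. -/
def pastDecisions {Ω : Type*} {E : Type*} (X : ℕ → Ω → E) (k : ℕ) : Ω → (Fin k → E) :=
  fun ω i => X i ω

/-- The sigma algebra generated by the first `k` decisions `X 0, …, X (k - 1)`
(the trivial sigma algebra for `k = 0`). -/
abbrev pastSigma {Ω : Type*} {E : Type*} [MeasurableSpace E] (X : ℕ → Ω → E) (k : ℕ) :
    MeasurableSpace Ω :=
  MeasurableSpace.comap (pastDecisions X k) inferInstance

/-! The key observation is that `rateRegion lam C` is the set of means `∫ p, p.2 ∂μ` over all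
probability measures `μ` on `ΩS × ℝ^m` that are concentrated on the graph of `C` and have first
marginal `lam`. A randomized choice `v (T, U)` clearly yields such a law. Conversely, `μ`
disintegrates as `lam` followed by a Markov kernel, and a Markov kernel into a standard Borel space
is the image of the uniform distribution under a measurable function of the state and the uniform
variable (`integral_snd_mem_rateRegion`). In particular the region is convex
(`convex_rateRegion`), and it contains `E[Y]` whenever `Y` respects the option sets of a state with
law `lam` (`integral_mem_rateRegion`); this covers the expectations and their averages.

For conditional expectations, let `A` be a non-null event of the past. The current state is
independent of `A`, so under `P[|A]` it still has law `lam`, and the mean of the decision under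
`P[|A]` belongs to the region. A function whose averages over the non-null events of a sigma algebra
lie in a set has a conditional expectation in the closure of this set
(`condExp_mem_closure_of_forall_cond`).

For the limit, the differences between the decisions and their conditional expectations given the
past are bounded and pairwise orthogonal, so their averages tend to zero almost surely
(`ae_tendsto_average_zero_of_orthogonal`). The averages of the conditional expectations stay in the
closure of the region by convexity, hence the averages of the decisions approach it. -/

/-! ### The rate region as a set of means of joint laws -/

/-- If `f a` turns a uniform variable into one with law `μ.condKernel a`, then
`(a, u) ↦ (a, f a u)` turns an independent pair with laws `μ.fst` and uniform into a pair with
law `μ`. -/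
theorem map_prodMk_prod_eq_of_condKernel {α β : Type*} [MeasurableSpace α] [MeasurableSpace β]
    [StandardBorelSpace β] [Nonempty β] (μ : Measure (α × β)) [IsFiniteMeasure μ]
    {f : α → unitInterval → β} (hf : Measurable (Function.uncurry f))
    (hfκ : ∀ a, (volume : Measure unitInterval).map (f a) = μ.condKernel a) :
    (μ.fst.prod volume).map (fun p : α × unitInterval => (p.1, f p.1 p.2)) = μ := by
  have hmeas : Measurable (fun p : α × unitInterval => (p.1, f p.1 p.2)) :=
    measurable_fst.prodMk hf
  conv_rhs => rw [← μ.disintegrate μ.condKernel]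
  ext s hs
  rw [Measure.map_apply hmeas hs, Measure.prod_apply (hmeas hs), Measure.compProd_apply hs]
  refine lintegral_congr fun a => ?_
  rw [← hfκ a, Measure.map_apply (by fun_prop) (measurable_prodMk_left hs)]
  rfl

section RateRegion

variable {ΩS : Type u} [MeasurableSpace ΩS] {m : ℕ} {lam : Measure ΩS}
  {C : ΩS → Set (EuclideanSpace ℝ (Fin m))}

/-- Every joint law of a state and a decision respecting the option sets can be realized with
independent randomization, so its mean decision belongs to the rate region. -/
theorem integral_snd_mem_rateRegion
    (hchoice : ∃ ψ : ΩS → EuclideanSpace ℝ (Fin m), Measurable ψ ∧ ∀ s, ψ s ∈ C s)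
    (hgraph : MeasurableSet {p : ΩS × EuclideanSpace ℝ (Fin m) | p.2 ∈ C p.1})
    (μ : Measure (ΩS × EuclideanSpace ℝ (Fin m))) [IsProbabilityMeasure μ]
    (hfst : μ.fst = lam) (hμ : ∀ᵐ p ∂μ, p.2 ∈ C p.1) :
    (∫ p, p.2 ∂μ) ∈ rateRegion lam C := by
  classical
  obtain ⟨ψ, hψ, hψC⟩ := hchoice
  obtain ⟨f, hf, hfκ⟩ := Kernel.exists_measurable_map_eq_unitInterval μ.condKernel
  have hmap := map_prodMk_prod_eq_of_condKernel μ hf hfκ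
  have hgmeas : Measurable (fun p : ΩS × unitInterval => (p.1, f p.1 p.2)) :=
    measurable_fst.prodMk hf
  rw [hfst] at hmap
  have hlam : IsProbabilityMeasure lam := hfst ▸ inferInstance
  let w : ΩS × ℝ → EuclideanSpace ℝ (Fin m) := fun p =>
    f p.1 (Set.projIcc (0 : ℝ) 1 zero_le_one p.2)
  have hw : Measurable w := by
    have : Measurable (fun p : ΩS × ℝ => (p.1, Set.projIcc (0 : ℝ) 1 zero_le_one p.2)) :=
      measurable_fst.prodMk (continuous_projIcc.measurable.comp measurable_snd)
    exact hf.comp this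
  have hwg : MeasurableSet {p : ΩS × ℝ | w p ∈ C p.1} :=
    (measurable_fst.prodMk hw) hgraph
  -- `w` respects `C` only almost surely; on the exceptional set it is replaced by the measurable
  -- selection `ψ`, so that the constraint holds everywhere.
  refine ⟨fun p => if w p ∈ C p.1 then w p else ψ p.1,
    Measurable.ite hwg hw (hψ.comp measurable_fst), fun s t => ?_,
    ΩS × unitInterval, inferInstance, lam.prod volume, Prod.fst, Prod.snd, inferInstance,
    measurable_fst, measurable_snd, ?_, ?_, ?_, ?_⟩
  · dsimp only
    split_ifs with h
    · exact h
    · exact hψC s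
  · exact Measure.fst_prod
  · exact Measure.snd_prod
  · exact indepFun_prod measurable_id measurable_id
  · rw [← hmap, integral_map hgmeas.aemeasurable (by fun_prop)]
    rw [← hmap] at hμ
    have hμ' := ae_of_ae_map hgmeas.aemeasurable hμ
    refine integral_congr_ae ?_
    filter_upwards [hμ'] with p hp
    have : w (p.1, (p.2 : ℝ)) = f p.1 p.2 := by simp [w]
    simp only [this]
    rw [if_pos hp]

/-- The probability space `Ω` may live in any universe: only the joint law of `(T, Y)` matters. -/
theorem integral_mem_rateRegion {Ω : Type*} [MeasurableSpace Ω]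
    (hchoice : ∃ ψ : ΩS → EuclideanSpace ℝ (Fin m), Measurable ψ ∧ ∀ s, ψ s ∈ C s)
    (hgraph : MeasurableSet {p : ΩS × EuclideanSpace ℝ (Fin m) | p.2 ∈ C p.1})
    (Q : Measure Ω) [IsProbabilityMeasure Q] {T : Ω → ΩS} (hT : Measurable T)
    (hlaw : Q.map T = lam) {Y : Ω → EuclideanSpace ℝ (Fin m)} (hY : Measurable Y)
    (hYC : ∀ ω, Y ω ∈ C (T ω)) : (∫ ω, Y ω ∂Q) ∈ rateRegion lam C := by
  have hTY := hT.prodMk hY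
  have : IsProbabilityMeasure (Q.map fun ω => (T ω, Y ω)) :=
    Measure.isProbabilityMeasure_map hTY.aemeasurable
  have h := integral_snd_mem_rateRegion (lam := lam) hchoice hgraph (Q.map fun ω => (T ω, Y ω))
    (by rw [Measure.fst_map_prodMk hY, hlaw])
    ((ae_map_iff hTY.aemeasurable hgraph).2 (ae_of_all _ hYC))
  rwa [integral_map hTY.aemeasurable (by fun_prop)] at h

/-- Converse of `integral_snd_mem_rateRegion`: points of the rate region are mean decisions of
joint laws on the graph of `C` with first marginal `lam`. -/
theorem exists_law_of_mem_rateRegion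
    (hgraph : MeasurableSet {p : ΩS × EuclideanSpace ℝ (Fin m) | p.2 ∈ C p.1})
    {x : EuclideanSpace ℝ (Fin m)} (hx : x ∈ rateRegion lam C) :
    ∃ μ : Measure (ΩS × EuclideanSpace ℝ (Fin m)), IsProbabilityMeasure μ ∧ μ.fst = lam ∧
      (∀ᵐ p ∂μ, p.2 ∈ C p.1) ∧ ∫ p, p.2 ∂μ = x := by
  obtain ⟨v, hv, hvC, Ω', _, P', T, U, _, hT, hU, hTlaw, -, -, rfl⟩ := hx
  have hY : Measurable (fun ω => v (T ω, (U ω : ℝ))) :=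
    hv.comp (hT.prodMk hU.subtype_val)
  have hTY := hT.prodMk hY
  refine ⟨P'.map fun ω => (T ω, v (T ω, (U ω : ℝ))),
    Measure.isProbabilityMeasure_map hTY.aemeasurable, ?_, ?_, ?_⟩
  · rw [Measure.fst_map_prodMk hY, hTlaw]
  · exact (ae_map_iff hTY.aemeasurable hgraph).2 (ae_of_all _ fun ω => hvC _ _)
  · rw [integral_map hTY.aemeasurable (by fun_prop)]

/-- The joint laws on the graph of `C` with first marginal `lam` form a convex set, and the mean is
affine in the law. The bound on `C` is what makes the means integrals of integrable functions. -/
theorem convex_rateRegion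
    (hchoice : ∃ ψ : ΩS → EuclideanSpace ℝ (Fin m), Measurable ψ ∧ ∀ s, ψ s ∈ C s)
    (hgraph : MeasurableSet {p : ΩS × EuclideanSpace ℝ (Fin m) | p.2 ∈ C p.1})
    {R : ℝ} (hR : ∀ s, ∀ x ∈ C s, ‖x‖ ≤ R) : Convex ℝ (rateRegion lam C) := by
  intro x hx y hy a b ha hb hab
  obtain ⟨μ, _, hμ, hμC, rfl⟩ := exists_law_of_mem_rateRegion hgraph hx
  obtain ⟨ν, _, hν, hνC, rfl⟩ := exists_law_of_mem_rateRegion hgraph hy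
  have hsum : ENNReal.ofReal a + ENNReal.ofReal b = 1 := by
    rw [← ENNReal.ofReal_add ha hb, hab, ENNReal.ofReal_one]
  have hint : ∀ ρ : Measure (ΩS × EuclideanSpace ℝ (Fin m)), IsProbabilityMeasure ρ →
      (∀ᵐ p ∂ρ, p.2 ∈ C p.1) → Integrable (fun p => p.2) ρ := fun ρ _ hρ =>
    Integrable.of_bound (by fun_prop) R (hρ.mono fun p hp => hR _ _ hp)
  have : IsProbabilityMeasure (ENNReal.ofReal a • μ + ENNReal.ofReal b • ν) :=
    ⟨by simp [hsum]⟩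
  have h := integral_snd_mem_rateRegion (lam := lam) hchoice hgraph
    (ENNReal.ofReal a • μ + ENNReal.ofReal b • ν)
    (by
      rw [Measure.fst] at hμ hν
      rw [Measure.fst_add, Measure.fst, Measure.fst, Measure.map_smul, Measure.map_smul, hμ, hν,
        ← add_smul, hsum, one_smul])
    (ae_add_measure_iff.2 ⟨Measure.ae_smul_measure hμC _, Measure.ae_smul_measure hνC _⟩)
  rwa [integral_add_measure ((hint μ ‹_› hμC).smul_measure ENNReal.ofReal_ne_top)
    ((hint ν ‹_› hνC).smul_measure ENNReal.ofReal_ne_top), integral_smul_measure,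
    integral_smul_measure, ENNReal.toReal_ofReal ha, ENNReal.toReal_ofReal hb] at h

end RateRegion

/-! ### Conditional expectations with values in a closed set -/

/-- If all averages of `f` over preimages of Borel sets lie in a closed set `K`, then `f ∈ K` almost
everywhere. The set `K` need not be convex: a point outside `K` has a closed ball around it that
misses `K`, and the average over the preimage of this ball lies in the ball. -/
theorem ae_mem_of_forall_setAverage_mem {Ω E : Type*} {m : MeasurableSpace Ω}
    [NormedAddCommGroup E] [NormedSpace ℝ E] [CompleteSpace E] [SecondCountableTopology E]
    [MeasurableSpace E] [BorelSpace E]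
    {μ : Measure Ω} [IsFiniteMeasure μ] {f : Ω → E} (hf : Integrable f μ) (hfm : Measurable f)
    {K : Set E} (hK : IsClosed K)
    (h : ∀ B : Set E, MeasurableSet B → μ (f ⁻¹' B) ≠ 0 → (⨍ ω in f ⁻¹' B, f ω ∂μ) ∈ K) :
    ∀ᵐ ω ∂μ, f ω ∈ K := by
  have hnull : (μ.map f) Kᶜ = 0 := by
    refine measure_null_of_locally_null _ fun x hx => ?_
    obtain ⟨ε, hε, hball⟩ := Metric.nhds_basis_closedBall.mem_iff.1 (hK.isOpen_compl.mem_nhds hx)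
    refine ⟨Metric.closedBall x ε, mem_nhdsWithin_of_mem_nhds (Metric.closedBall_mem_nhds x hε), ?_⟩
    rw [Measure.map_apply hfm Metric.isClosed_closedBall.measurableSet]
    by_contra hne
    -- The average over the preimage of the ball would be in the ball and in `K`.
    refine hball ?_ (h _ Metric.isClosed_closedBall.measurableSet hne)
    exact (convex_closedBall x ε).set_average_mem Metric.isClosed_closedBall hne
      (measure_ne_top _ _)
      (ae_restrict_mem (hfm Metric.isClosed_closedBall.measurableSet)) hf.integrableOn
  rwa [Measure.map_apply hfm hK.isOpen_compl.measurableSet] at hnull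

/-- If the mean of `Y` conditioned on each non-null event of `m` lies in `K`, then the conditional
expectation given `m` takes values in the closure of `K`. -/
theorem condExp_mem_closure_of_forall_cond {Ω E : Type*} {m₀ : MeasurableSpace Ω}
    [NormedAddCommGroup E] [NormedSpace ℝ E] [CompleteSpace E] [SecondCountableTopology E]
    [MeasurableSpace E] [BorelSpace E]
    {μ : Measure Ω} [IsFiniteMeasure μ] {m : MeasurableSpace Ω} (hm : m ≤ m₀)
    {Y : Ω → E} (hY : Integrable Y μ) {K : Set E}
    (h : ∀ A : Set Ω, MeasurableSet[m] A → μ A ≠ 0 → (∫ ω, Y ω ∂(μ[|A])) ∈ K) :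
    ∀ᵐ ω ∂μ, (μ[Y | m]) ω ∈ closure K := by
  have hmeas : Measurable[m] (μ[Y | m]) := stronglyMeasurable_condExp.measurable
  refine ae_mem_of_forall_setAverage_mem integrable_condExp (hmeas.mono hm le_rfl)
    isClosed_closure fun B hB hne => subset_closure ?_
  have hA : MeasurableSet[m] ((μ[Y | m]) ⁻¹' B) := hmeas hB
  have := h _ hA hne
  rw [ProbabilityTheory.cond, integral_smul_measure, ← setIntegral_condExp hm hY hA] at this
  rwa [setAverage_eq, measureReal_def, ← ENNReal.toReal_inv]

theorem map_cond_of_indep {Ω α : Type*} {m m₀ : MeasurableSpace Ω} [MeasurableSpace α]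
    {μ : Measure Ω} [IsProbabilityMeasure μ] (hm : m ≤ m₀)
    {T : Ω → α} (hT : Measurable T) (hind : Indep (MeasurableSpace.comap T inferInstance) m μ)
    {A : Set Ω} (hA : MeasurableSet[m] A) (hne : μ A ≠ 0) : (μ[|A]).map T = μ.map T := by
  ext s hs
  rw [Measure.map_apply hT hs, Measure.map_apply hT hs, cond_apply (hm A hA), Set.inter_comm,
    (Indep_iff _ _ _).1 hind _ _ ⟨s, hs, rfl⟩ hA, mul_comm, mul_assoc,
    ENNReal.mul_inv_cancel hne (measure_ne_top _ _), mul_one]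

/-! ### A strong law of large numbers for orthogonal random vectors -/

section LLN

variable {E : Type*} [NormedAddCommGroup E]

/-- For bounded sequences it suffices to know convergence of the averages along the squares: with
`q = √n` rounded down, the sum up to `n` has at most `2 * q` more terms than the sum up to
`q ^ 2`. -/
theorem tendsto_average_of_tendsto_average_sq [NormedSpace ℝ E] {x : ℕ → E} {R : ℝ}
    (hx : ∀ i, ‖x i‖ ≤ R)
    (h : Tendsto (fun n : ℕ => (1 / ((n ^ 2 : ℕ) : ℝ)) • ∑ i ∈ Finset.range (n ^ 2), x i)
      atTop (𝓝 0)) :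
    Tendsto (fun n : ℕ => (1 / (n : ℝ)) • ∑ i ∈ Finset.range n, x i) atTop (𝓝 0) := by
  have hR : 0 ≤ R := (norm_nonneg _).trans (hx 0)
  have hsqrt : Tendsto Nat.sqrt atTop atTop :=
    tendsto_atTop_mono' _ (Eventually.of_forall fun n => le_rfl)
      (tendsto_atTop_atTop.2 fun b => ⟨b ^ 2, fun a ha => Nat.le_sqrt'.2 ha⟩)
  have hlim : Tendsto (fun q : ℕ =>
      ‖(1 / ((q ^ 2 : ℕ) : ℝ)) • ∑ i ∈ Finset.range (q ^ 2), x i‖ + 2 * R / (q : ℝ))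
      atTop (𝓝 0) := by
    simpa using h.norm.add (tendsto_const_div_atTop_nhds_zero_nat (2 * R))
  refine squeeze_zero_norm' ?_ (hlim.comp hsqrt)
  filter_upwards [eventually_ge_atTop 1] with n hn
  set q := Nat.sqrt n with hq
  have hq1 : 1 ≤ q := Nat.le_sqrt'.2 (by simpa using hn)
  have hqn : q ^ 2 ≤ n := Nat.sqrt_le' n
  have hnq : n ≤ q ^ 2 + 2 * q := by
    have := Nat.sqrt_le_add n
    rw [← hq] at this
    nlinarith
  have hq0 : (0 : ℝ) < q := by exact_mod_cast hq1
  have hn0 : (0 : ℝ) < n := by exact_mod_cast hn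
  have hqnR : ((q ^ 2 : ℕ) : ℝ) ≤ n := by exact_mod_cast hqn
  have hq2 : (0 : ℝ) < ((q ^ 2 : ℕ) : ℝ) := by positivity
  rw [Function.comp_apply, ← Finset.sum_range_add_sum_Ico _ hqn, smul_add]
  refine (norm_add_le _ _).trans (add_le_add ?_ ?_)
  · rw [norm_smul, norm_smul]
    gcongr
    rw [Real.norm_of_nonneg (by positivity), Real.norm_of_nonneg (by positivity)]
    gcongr
  · have hsum : ‖∑ i ∈ Finset.Ico (q ^ 2) n, x i‖ ≤ 2 * q * R := by
      refine (norm_sum_le_of_le _ fun i _ => hx i).trans ?_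
      rw [Finset.sum_const, Nat.card_Ico, nsmul_eq_mul]
      gcongr
      have : n - q ^ 2 ≤ 2 * q := by omega
      exact_mod_cast this
    rw [norm_smul, Real.norm_of_nonneg (by positivity)]
    calc 1 / (n : ℝ) * ‖∑ i ∈ Finset.Ico (q ^ 2) n, x i‖
        ≤ 1 / ((q ^ 2 : ℕ) : ℝ) * (2 * q * R) := by gcongr
      _ = 2 * R / q := by push_cast; field_simp

theorem integrable_inner_of_memLp_two [InnerProductSpace ℝ E] {Ω : Type*} [MeasurableSpace Ω]
    {μ : Measure Ω} {f g : Ω → E} (hf : MemLp f 2 μ) (hg : MemLp g 2 μ) :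
    Integrable (fun ω => inner ℝ (f ω) (g ω)) μ :=
  (hf.norm.integrable_mul hg.norm).mono' (hf.1.inner hg.1)
    (ae_of_all _ fun _ => norm_inner_le_norm _ _)

theorem integral_norm_sq_sum_le_of_orthogonal [InnerProductSpace ℝ E] {Ω : Type*}
    [MeasurableSpace Ω] {μ : Measure Ω} [IsProbabilityMeasure μ] {D : ℕ → Ω → E} {R : ℝ}
    (hD : ∀ i, AEStronglyMeasurable (D i) μ) (hR : ∀ i, ∀ᵐ ω ∂μ, ‖D i ω‖ ≤ R)
    (horth : ∀ i j, i < j → ∫ ω, inner ℝ (D i ω) (D j ω) ∂μ = 0) (n : ℕ) :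
    ∫ ω, ‖∑ i ∈ Finset.range n, D i ω‖ ^ 2 ∂μ ≤ n * R ^ 2 := by
  have hL2 : ∀ i, MemLp (D i) 2 μ := fun i => MemLp.of_bound (hD i) R (hR i)
  induction n with
  | zero => simp
  | succ n ih =>
    have hS : MemLp (fun ω => ∑ i ∈ Finset.range n, D i ω) 2 μ :=
      memLp_finsetSum _ fun i _ => hL2 i
    have hcross : ∫ ω, inner ℝ (∑ i ∈ Finset.range n, D i ω) (D n ω) ∂μ = 0 := by
      simp_rw [sum_inner]
      rw [integral_finsetSum _ fun i _ => integrable_inner_of_memLp_two (hL2 i) (hL2 n)]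
      exact Finset.sum_eq_zero fun i hi => horth i n (Finset.mem_range.1 hi)
    have hlast : ∫ ω, ‖D n ω‖ ^ 2 ∂μ ≤ R ^ 2 := by
      have := integral_mono_ae (hL2 n).norm.integrable_sq (integrable_const (R ^ 2))
        ((hR n).mono fun ω hω => pow_le_pow_left₀ (norm_nonneg _) hω 2)
      simpa using this
    simp_rw [Finset.sum_range_succ, norm_add_sq_real]
    have hSi := hS.norm.integrable_sq
    have hci := (integrable_inner_of_memLp_two hS (hL2 n)).const_mul 2
    rw [integral_add (by exact hSi.add hci) (hL2 n).norm.integrable_sq, integral_add hSi hci,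
      integral_const_mul, hcross]
    push_cast
    linarith

/-- Strong law of large numbers for bounded, pairwise orthogonal random vectors. The second moment
of the average of `n ^ 2` terms is at most `R ^ 2 / n ^ 2`, which is summable, so these averages
tend to zero almost surely. -/
theorem ae_tendsto_average_zero_of_orthogonal [InnerProductSpace ℝ E] {Ω : Type*}
    [MeasurableSpace Ω] {μ : Measure Ω} [IsProbabilityMeasure μ] {D : ℕ → Ω → E} {R : ℝ}
    (hD : ∀ i, AEStronglyMeasurable (D i) μ) (hR : ∀ i, ∀ᵐ ω ∂μ, ‖D i ω‖ ≤ R)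
    (horth : ∀ i j, i < j → ∫ ω, inner ℝ (D i ω) (D j ω) ∂μ = 0) :
    ∀ᵐ ω ∂μ, Tendsto (fun n : ℕ => (1 / (n : ℝ)) • ∑ i ∈ Finset.range n, D i ω) atTop (𝓝 0) := by
  set F : ℕ → Ω → ℝ := fun n ω =>
    ‖(1 / ((n ^ 2 : ℕ) : ℝ)) • ∑ i ∈ Finset.range (n ^ 2), D i ω‖ ^ 2 with hF
  have hL2 : ∀ i, MemLp (D i) 2 μ := fun i => MemLp.of_bound (hD i) R (hR i)
  have hFint : ∀ n, Integrable (F n) μ := fun n =>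
    (((memLp_finsetSum _ fun i _ => hL2 i).const_smul _).norm).integrable_sq
  have hFle : ∀ n, ∫ ω, F n ω ∂μ ≤ R ^ 2 * (1 / (n : ℝ) ^ 2) := fun n => by
    have h := integral_norm_sq_sum_le_of_orthogonal hD hR horth (n ^ 2)
    simp only [hF, norm_smul, mul_pow]
    rw [integral_const_mul]
    rcases n.eq_zero_or_pos with rfl | hn
    · simp
    · have hn0 : (0 : ℝ) < n := by exact_mod_cast hn
      calc _ ≤ ‖1 / ((n ^ 2 : ℕ) : ℝ)‖ ^ 2 * (((n ^ 2 : ℕ) : ℝ) * R ^ 2) := by gcongr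
        _ = _ := by
          rw [Real.norm_of_nonneg (by positivity)]
          push_cast
          field_simp
  have hsum : ∑' n, ∫⁻ ω, ENNReal.ofReal (F n ω) ∂μ ≠ ⊤ := by
    have hs : Summable fun n : ℕ => R ^ 2 * (1 / (n : ℝ) ^ 2) :=
      (Real.summable_one_div_nat_pow.2 one_lt_two).mul_left _
    refine ne_top_of_le_ne_top hs.tsum_ofReal_ne_top (ENNReal.tsum_le_tsum fun n => ?_)
    rw [← ofReal_integral_eq_lintegral_ofReal (hFint n) (ae_of_all _ fun ω => by positivity)]
    exact ENNReal.ofReal_le_ofReal (hFle n)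
  have haem : ∀ n, AEMeasurable (fun ω => ENNReal.ofReal (F n ω)) μ := fun n =>
    (hFint n).aestronglyMeasurable.aemeasurable.ennreal_ofReal
  rw [← lintegral_tsum haem] at hsum
  filter_upwards [ae_lt_top' (AEMeasurable.tsum haem) hsum, ae_all_iff.2 hR] with ω hω hRω
  refine tendsto_average_of_tendsto_average_sq hRω ?_
  have h0 := ENNReal.tendsto_atTop_zero_of_tsum_ne_top hω.ne
  have h1 : Tendsto (fun n => F n ω) atTop (𝓝 0) := by
    have := (ENNReal.tendsto_toReal ENNReal.zero_ne_top).comp h0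
    refine this.congr fun n => ?_
    exact ENNReal.toReal_ofReal (by positivity)
  have h2 := h1.sqrt
  rw [Real.sqrt_zero] at h2
  refine tendsto_zero_iff_norm_tendsto_zero.2 (h2.congr fun n => ?_)
  exact Real.sqrt_sq (norm_nonneg _)

end LLN

/-- The error of the conditional expectation is orthogonal to every `m`-measurable vector. -/
theorem integral_inner_sub_condExp_eq_zero {Ω E : Type*} {m m₀ : MeasurableSpace Ω}
    [NormedAddCommGroup E] [InnerProductSpace ℝ E] [CompleteSpace E]
    {μ : Measure Ω} [IsFiniteMeasure μ] (hm : m ≤ m₀)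
    {Z Y : Ω → E} (hZ : StronglyMeasurable[m] Z) (hZ2 : MemLp Z 2 μ) (hY : MemLp Y 2 μ) :
    ∫ ω, inner ℝ (Z ω) (Y ω - (μ[Y | m]) ω) ∂μ = 0 := by
  have hYi : Integrable Y μ := hY.integrable one_le_two
  have hW : MemLp (Y - μ[Y | m]) 2 μ := hY.sub (hY.condExp one_le_two)
  have hpull := condExp_bilin_of_stronglyMeasurable_left (μ := μ) (innerSL ℝ (E := E)) hZ
    (g := Y - μ[Y | m]) (integrable_inner_of_memLp_two hZ2 hW) (hW.integrable one_le_two)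
  have hzero : μ[Y - μ[Y | m] | m] =ᵐ[μ] 0 := by
    refine (condExp_sub hYi integrable_condExp m).trans ?_
    rw [condExp_of_stronglyMeasurable hm stronglyMeasurable_condExp integrable_condExp, sub_self]
  calc ∫ ω, inner ℝ (Z ω) (Y ω - (μ[Y | m]) ω) ∂μ
      = ∫ ω, (μ[fun ω => innerSL ℝ (Z ω) ((Y - μ[Y | m]) ω) | m]) ω ∂μ :=
        (integral_condExp hm).symm
    _ = 0 := integral_eq_zero_of_ae <| by
        filter_upwards [hpull, hzero] with ω h1 h2
        change (μ[fun ω => innerSL ℝ (Z ω) ((Y - μ[Y | m]) ω) | m]) ω = 0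
        rw [h1, h2, Pi.zero_apply, map_zero]

/-! ### The sigma algebras of past decisions -/

theorem measurable_pastDecisions {Ω E : Type*} [MeasurableSpace Ω] [MeasurableSpace E]
    {X : ℕ → Ω → E} (hX : ∀ k, Measurable (X k)) (k : ℕ) : Measurable (pastDecisions X k) :=
  measurable_pi_lambda _ fun i => hX i

theorem measurable_pastSigma_of_lt {Ω E : Type*} [MeasurableSpace E] (X : ℕ → Ω → E) {i j : ℕ}
    (hij : i < j) : Measurable[pastSigma X j] (X i) :=
  (measurable_pi_apply (⟨i, hij⟩ : Fin j)).comp (comap_measurable (pastDecisions X j))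

theorem pastSigma_mono {Ω E : Type*} [MeasurableSpace E] (X : ℕ → Ω → E) :
    Monotone (pastSigma X) := fun _ j hij =>
  @Measurable.comap_le _ _ (pastSigma X j) _ _ <| @measurable_pi_lambda _ _ _ (pastSigma X j) _ _
    fun a => measurable_pastSigma_of_lt X (a.2.trans_le hij)

/-! ### Conditional means and averages of the decisions -/

/-- Conditioning on an event of `H` leaves the law of the independent state `T` unchanged, so the
conditional mean of `Y` is again a point of the rate region. -/
theorem condExp_mem_closure_rateRegion {Ω : Type*} {ΩS : Type u} {H m₀ : MeasurableSpace Ω}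
    [MeasurableSpace ΩS] {m : ℕ} {P : Measure Ω} [IsProbabilityMeasure P]
    {C : ΩS → Set (EuclideanSpace ℝ (Fin m))} {lam : Measure ΩS}
    (hchoice : ∃ ψ : ΩS → EuclideanSpace ℝ (Fin m), Measurable ψ ∧ ∀ s, ψ s ∈ C s)
    (hgraph : MeasurableSet {p : ΩS × EuclideanSpace ℝ (Fin m) | p.2 ∈ C p.1})
    (hH : H ≤ m₀)
    {T : Ω → ΩS} (hT : Measurable T) (hlaw : P.map T = lam)
    (hind : Indep (MeasurableSpace.comap T inferInstance) H P)
    {Y : Ω → EuclideanSpace ℝ (Fin m)} (hY : Measurable Y) (hYint : Integrable Y P)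
    (hYC : ∀ ω, Y ω ∈ C (T ω)) :
    ∀ᵐ ω ∂P, (P[Y | H]) ω ∈ closure (rateRegion lam C) := by
  refine condExp_mem_closure_of_forall_cond hH hYint fun A hA hne => ?_
  have : IsProbabilityMeasure (P[|A]) := cond_isProbabilityMeasure hne
  exact integral_mem_rateRegion hchoice hgraph _ hT
    ((map_cond_of_indep hH hT hind hA hne).trans hlaw) hY hYC

/-- The martingale differences `X i - E[X i | X 0, …, X (i - 1)]` average out to zero: they are
bounded, and they are orthogonal since the earlier ones are measurable with respect to the later
past. -/
theorem ae_tendsto_average_sub_condExp {Ω E : Type*} [MeasurableSpace Ω] {P : Measure Ω}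
    [IsProbabilityMeasure P] [NormedAddCommGroup E] [InnerProductSpace ℝ E] [CompleteSpace E]
    [SecondCountableTopology E] [MeasurableSpace E] [BorelSpace E]
    {X : ℕ → Ω → E} (hX : ∀ k, Measurable (X k)) {R : ℝ} (hR : ∀ k ω, ‖X k ω‖ ≤ R) :
    ∀ᵐ ω ∂P, Tendsto (fun n : ℕ => (1 / (n : ℝ)) •
      ∑ i ∈ Finset.range n, (X i ω - (P[X i | pastSigma X i]) ω)) atTop (𝓝 0) := by
  have hle : ∀ k, pastSigma X k ≤ ‹MeasurableSpace Ω› := fun k =>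
    (measurable_pastDecisions hX k).comap_le
  have hL2 : ∀ k, MemLp (X k) 2 P := fun k =>
    MemLp.of_bound (hX k).aestronglyMeasurable R (ae_of_all _ (hR k))
  have hce : ∀ k, ∀ᵐ ω ∂P, ‖(P[X k | pastSigma X k]) ω‖ ≤ R := fun k => by
    have := condExp_mem_closure_of_forall_cond (hle k) ((hL2 k).integrable one_le_two)
      (K := Metric.closedBall (0 : E) R) fun A _ hne => by
        have : IsProbabilityMeasure (P[|A]) := cond_isProbabilityMeasure hne
        simpa using norm_integral_le_of_norm_le_const (μ := P[|A]) (ae_of_all _ (hR k))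
    rw [Metric.isClosed_closedBall.closure_eq] at this
    simpa using this
  have hD : ∀ k, MemLp (fun ω => X k ω - (P[X k | pastSigma X k]) ω) 2 P := fun k =>
    (hL2 k).sub ((hL2 k).condExp one_le_two)
  refine ae_tendsto_average_zero_of_orthogonal (R := R + R) (fun k => (hD k).1)
    (fun k => ?_) fun i j hij => ?_
  · filter_upwards [hce k] with ω hω
    exact (norm_sub_le _ _).trans (add_le_add (hR k ω) hω)
  · exact integral_inner_sub_condExp_eq_zero (hle j)
      ((measurable_pastSigma_of_lt X hij).stronglyMeasurable.sub
        (stronglyMeasurable_condExp.mono (pastSigma_mono X hij.le))) (hD i) (hL2 j)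

theorem Convex.average_range_mem {E : Type*} [AddCommGroup E] [Module ℝ E] {K : Set E}
    (hK : Convex ℝ K) {n : ℕ} (hn : 1 ≤ n) {y : ℕ → E} (hy : ∀ i ∈ Finset.range n, y i ∈ K) :
    (1 / (n : ℝ)) • ∑ i ∈ Finset.range n, y i ∈ K := by
  have hn0 : (n : ℝ) ≠ 0 := by positivity
  rw [Finset.smul_sum]
  exact hK.sum_mem (fun _ _ => by positivity) (by simp [hn0]) hy

theorem tendsto_infDist_average {E : Type*} [NormedAddCommGroup E] [NormedSpace ℝ E]
    {K : Set E} (hK : Convex ℝ K) {x y : ℕ → E} (hy : ∀ i, y i ∈ K)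
    (h : Tendsto (fun n : ℕ => (1 / (n : ℝ)) • ∑ i ∈ Finset.range n, (x i - y i)) atTop (𝓝 0)) :
    Tendsto (fun n : ℕ => Metric.infDist ((1 / (n : ℝ)) • ∑ i ∈ Finset.range n, x i) K)
      atTop (𝓝 0) := by
  refine squeeze_zero' (Eventually.of_forall fun _ => Metric.infDist_nonneg) ?_
    (by simpa only [norm_zero] using h.norm)
  filter_upwards [eventually_ge_atTop 1] with n hn
  refine (Metric.infDist_le_dist_of_mem (hK.average_range_mem hn fun i _ => hy i)).trans_eq ?_
  rw [dist_eq_norm, ← smul_sub, ← Finset.sum_sub_distrib]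

/-- Slots are numbered `0, 1, 2, …`, so `S k` and `X k` belong to the `(k+1)`-st slot. -/
theorem proposition3 {Ω ΩS : Type*} [MeasurableSpace Ω] [MeasurableSpace ΩS] {m : ℕ}
    (P : Measure Ω) [IsProbabilityMeasure P]
    (C : ΩS → Set (EuclideanSpace ℝ (Fin m)))
    -- a measurable choice function exists
    (hchoice : ∃ ψ : ΩS → EuclideanSpace ℝ (Fin m), Measurable ψ ∧ ∀ s, ψ s ∈ C s)
    -- the graph of `C` is measurable
    (hgraph : MeasurableSet {p : ΩS × EuclideanSpace ℝ (Fin m) | p.2 ∈ C p.1})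
    -- the option sets are nonempty and uniformly bounded
    (hbdd : ∃ D : Set (EuclideanSpace ℝ (Fin m)), Bornology.IsBounded D ∧
      ∀ s, (C s).Nonempty ∧ C s ⊆ D)
    -- identically distributed states with distribution `lam`
    (lam : Measure ΩS) (S : ℕ → Ω → ΩS) (hS : ∀ k, Measurable (S k))
    (hlaw : ∀ k, P.map (S k) = lam)
    -- measurable decisions that surely respect the option sets
    (X : ℕ → Ω → EuclideanSpace ℝ (Fin m)) (hX : ∀ k, Measurable (X k))
    (hXC : ∀ k ω, X k ω ∈ C (S k ω)) :
    -- (a)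
    ((∀ k, (∫ ω, X k ω ∂P) ∈ rateRegion lam C) ∧
      (∀ k : ℕ, 1 ≤ k →
        ((1 / (k : ℝ)) • ∑ i ∈ Finset.range k, ∫ ω, X i ω ∂P) ∈ rateRegion lam C)) ∧
    -- (b)
    (iIndepFun S P → (∀ k, 1 ≤ k → IndepFun (S k) (pastDecisions X k) P) →
      ∀ k, ∀ᵐ ω ∂P, (P[X k | pastSigma X k]) ω ∈ closure (rateRegion lam C)) ∧
    -- (c)
    (iIndepFun S P → (∀ k, 1 ≤ k → IndepFun (S k) (pastDecisions X k) P) →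
      ∀ᵐ ω ∂P, Tendsto
        (fun k : ℕ => Metric.infDist ((1 / (k : ℝ)) • ∑ i ∈ Finset.range k, X i ω)
          (closure (rateRegion lam C))) atTop (𝓝 0)) := by
  obtain ⟨D, hD, hCD⟩ := hbdd
  obtain ⟨R, hDR⟩ := hD.subset_closedBall 0
  have hR : ∀ s, ∀ x ∈ C s, ‖x‖ ≤ R := fun s x hx => by simpa using hDR ((hCD s).2 hx)
  have hXR : ∀ k ω, ‖X k ω‖ ≤ R := fun k ω => hR _ _ (hXC k ω)
  have hXint : ∀ k, Integrable (X k) P := fun k =>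
    Integrable.of_bound (hX k).aestronglyMeasurable R (ae_of_all _ (hXR k))
  have hconv : Convex ℝ (rateRegion lam C) := convex_rateRegion hchoice hgraph hR
  have hmean : ∀ k, (∫ ω, X k ω ∂P) ∈ rateRegion lam C := fun k =>
    integral_mem_rateRegion hchoice hgraph P (hS k) (hlaw k) (hX k) (hXC k)
  have hcond : (∀ k, 1 ≤ k → IndepFun (S k) (pastDecisions X k) P) →
      ∀ k, ∀ᵐ ω ∂P, (P[X k | pastSigma X k]) ω ∈ closure (rateRegion lam C) := by
    intro hind k
    refine condExp_mem_closure_rateRegion hchoice hgraph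
      (measurable_pastDecisions hX k).comap_le (hS k) (hlaw k) ?_ (hX k) (hXint k) (hXC k)
    rcases Nat.eq_zero_or_pos k with rfl | hk
    · -- The empty history takes values in a one-point space, so it generates the trivial
      -- sigma algebra, which is independent of every other one.
      have hconst : pastDecisions X 0 = fun _ => finZeroElim :=
        funext fun _ => Subsingleton.elim _ _
      rw [hconst, MeasurableSpace.comap_const]
      exact indep_bot_right _
    · exact (IndepFun_iff_Indep _ _ _).1 (hind k hk)
  refine ⟨⟨hmean, fun k hk => hconv.average_range_mem hk fun i _ => hmean i⟩,
    fun _ => hcond, fun _ hind => ?_⟩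
  filter_upwards [ae_all_iff.2 (hcond hind), ae_tendsto_average_sub_condExp (P := P) hX hXR]
    with ω hmem hlim
  exact tendsto_infDist_average hconv.closure hmem hlim
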